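/- Let $\Sigma$ be an alphabet (a finite set of letters or, more generally, any effectively coded set of letters such as $\mathbb N$, which makes the statement uniform in the alphabet). For a language $K\subseteq\Sigma^*$ and a nonempty finite word $v\in\Sigma^+$, let $v^\omega=vvv\cdots$ and $Kv^\omega=\{uv^\omega : u\in K\}$, a set of $\omega$-words over $\Sigma$. Context-free languages are given by context-free grammars: a start symbol and a finite list of productions. (a) It is decidable, given a context-free grammar generating a language $K$ over $\Sigma$ and a nonempty word $v\in\Sigma^+$, whether the set $Kv^\omega$ is finite. (b) Every member of $Kv^\omega$ is a regular $\omega$-word, that is, of the form $xy^\omega$ with $x\in\Sigma^*$ and $y\in\Sigma^+$. If $Kv^\omega$ is finite, its members can be effectively enumerated: there is a computable function which, given a context-free grammar generating $K$ and a word $v\in\Sigma^+$ such that $Kv^\omega$ is finite, returns a finite list $u_1,\dots,u_n$ of finite words (with $n\ge 0$) such that $Kv^\omega=\{u_iv^\omega : 1\le i\le n\}$. -/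

import Mathlib

noncomputable section

namespace OmegaLang

universe u

variable {α : Type u}

/-- The alphabet `α` consists of letters; an `ω`-word is a stream of letters. It is *regular* if it
is `u v v v …` for a finite word `u` and a nonempty finite word `v`. -/
def IsRegularWord (w : Stream' α) : Prop :=
  ∃ (u v : List α) (hv : v ≠ []), w = u ++ₛ Stream'.cycle v hv

/-- Nonempty finite words, `α⁺`. -/
abbrev NonemptyWord (α : Type u) : Type u := {v : List α // v ≠ []}

/-- The `ω`-power `v^ω = v v v …` of a nonempty word. -/
def omegaPow (v : NonemptyWord α) : Stream' α := Stream'.cycle v.1 v.2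

/-- The set `K v^ω = {u v^ω : u ∈ K}` of `ω`-words. -/
def mulOmegaPow (K : Language α) (v : NonemptyWord α) : Set (Stream' α) :=
  {w | ∃ u ∈ K, w = u ++ₛ omegaPow v}

/-- A context-free grammar over `α` written down as finite data: the start symbol and the list of
productions. Nonterminals are named by natural numbers; in a right-hand side, `Sum.inl n` is the
nonterminal `n` and `Sum.inr a` is the terminal letter `a`. -/
abbrev GrammarCode (α : Type u) : Type u := ℕ × List (ℕ × List (ℕ ⊕ α))

/-- Decode a symbol of a right-hand side. -/
def toSymbol : ℕ ⊕ α → Symbol α ℕ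
  | Sum.inl n => Symbol.nonterminal n
  | Sum.inr a => Symbol.terminal a

open Classical in
/-- The productions that are written down by a code. -/
def GrammarCode.rules (c : GrammarCode α) : Finset (ContextFreeRule α ℕ) :=
  (c.2.map fun r => (⟨r.1, r.2.map toSymbol⟩ : ContextFreeRule α ℕ)).toFinset

/-- The context-free grammar that is written down by a code. -/
def GrammarCode.toGrammar (c : GrammarCode α) : ContextFreeGrammar α where
  NT := ℕ
  initial := c.1
  rules := GrammarCode.rules c

/-- The language generated by the grammar that is written down by a code. -/
def GrammarCode.language (c : GrammarCode α) : Language α :=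
  (GrammarCode.toGrammar c).language

/-- Codes present exactly the context-free languages: every context-free language has a code
(for the converse, `GrammarCode.toGrammar` is a context-free grammar). -/
theorem isContextFree_iff_exists_code (L : Language α) :
    L.IsContextFree ↔ ∃ c : GrammarCode α, GrammarCode.language c = L := by
  classical
  constructor
  swap
  · rintro ⟨c, hc⟩
    exact ⟨GrammarCode.toGrammar c, hc⟩
  rintro ⟨g, rfl⟩
  -- the finitely many nonterminals that occur in the grammar, with injective names
  let S : Set g.NT := {x | x = g.initial ∨ ∃ r ∈ g.rules, x = r.input ∨
    Symbol.nonterminal x ∈ r.output}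
  have hSfin : S.Finite := by
    have h1 : S ⊆ {g.initial} ∪ ⋃ r ∈ g.rules, ({r.input} ∪
        {x | (Symbol.nonterminal x : Symbol α g.NT) ∈ r.output}) := by
      rintro x (h | ⟨r, hr, h⟩)
      · exact Or.inl h
      · exact Or.inr (Set.mem_biUnion hr h)
    refine Set.Finite.subset ?_ h1
    refine (Set.finite_singleton _).union (g.rules.finite_toSet.biUnion fun r _ => ?_)
    refine (Set.finite_singleton _).union ?_
    refine Set.Finite.preimage (f := fun x : g.NT => (Symbol.nonterminal x : Symbol α g.NT))
      (fun a _ b _ h => by simpa using h) (s := {y | y ∈ r.output}) (List.finite_toSet _)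
  obtain ⟨f, hf⟩ : ∃ f : g.NT → ℕ, Set.InjOn f S := by
    exact Set.countable_iff_exists_injOn.1 hSfin.countable
  let toSum : Symbol α g.NT → ℕ ⊕ α := fun s => match s with
    | Symbol.nonterminal x => Sum.inl (f x)
    | Symbol.terminal a => Sum.inr a
  let F : Symbol α g.NT → Symbol α ℕ := fun s => toSymbol (toSum s)
  let c : GrammarCode α := (f g.initial, g.rules.toList.map fun r =>
    (f r.input, r.output.map toSum))
  have hF_nt : ∀ x, F (Symbol.nonterminal x) = Symbol.nonterminal (f x) := fun _ => rfl
  have hF_t : ∀ a, F (Symbol.terminal a) = Symbol.terminal a := fun _ => rfl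
  have hrules : ∀ r' : ContextFreeRule α ℕ, r' ∈ GrammarCode.rules c ↔
      ∃ r ∈ g.rules, r' = ⟨f r.input, r.output.map F⟩ := by
    intro r'
    simp only [GrammarCode.rules, c, F, List.mem_toFinset, List.map_map, List.mem_map,
      Finset.mem_toList, Function.comp_def]
    exact exists_congr fun r => and_congr_right fun _ => eq_comm
  have hterm : ∀ w : List α, (w.map Symbol.terminal).map F = w.map Symbol.terminal := by
    intro w
    simp [hF_t]
  have hterm' : ∀ (w : List α) (u : List (Symbol α g.NT)),
      u.map F = w.map Symbol.terminal → u = w.map Symbol.terminal := by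
    intro w
    induction w with
    | nil => intro u h; simpa using h
    | cons a w ih =>
      rintro (_ | ⟨x, u⟩) h
      · simp at h
      · simp only [List.map_cons, List.cons.injEq] at h ⊢
        refine ⟨?_, ih u h.2⟩
        cases x with
        | terminal b => simpa [hF_t] using h.1
        | nonterminal x => simp [hF_nt] at h
  let R : List (Symbol α ℕ) → List (Symbol α ℕ) → Prop :=
    fun u v => ∃ r ∈ GrammarCode.rules c, r.Rewrites u v
  refine ⟨c, ?_⟩
  ext w
  change Relation.ReflTransGen R [Symbol.nonterminal (f g.initial)] (w.map Symbol.terminal) ↔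
    g.Derives [Symbol.nonterminal g.initial] (w.map Symbol.terminal)
  constructor
  · intro h
    have key : ∀ w', Relation.ReflTransGen R
        [Symbol.nonterminal (f g.initial)] w' →
        ∃ u, u.map F = w' ∧ (∀ x, Symbol.nonterminal x ∈ u → x ∈ S) ∧
          g.Derives [Symbol.nonterminal g.initial] u := by
      intro w' hw'
      induction hw' with
      | refl =>
        exact ⟨[Symbol.nonterminal g.initial], by simp [hF_nt],
          fun x hx => Or.inl (by simpa using hx), Relation.ReflTransGen.refl⟩
      | tail _ hp ih =>
        obtain ⟨u, rfl, hS, hd⟩ := ih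
        obtain ⟨r', hr', hrw⟩ := hp
        obtain ⟨r, hr, rfl⟩ := (hrules r').1 hr'
        obtain ⟨p, q, hu, rfl⟩ := hrw.exists_parts
        rw [List.append_assoc, List.map_eq_append_iff] at hu
        obtain ⟨p0, t, rfl, rfl, ht⟩ := hu
        rw [List.map_eq_append_iff] at ht
        obtain ⟨m, q0, rfl, hm, rfl⟩ := ht
        rw [List.map_eq_singleton_iff] at hm
        obtain ⟨x, rfl, hx⟩ := hm
        cases x with
        | terminal a => simp [hF_t] at hx
        | nonterminal x =>
          have hxf : f x = f r.input := by simpa [hF_nt] using hx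
          have hxr : x = r.input :=
            hf (hS x (by simp)) (Or.inr ⟨r, hr, Or.inl rfl⟩) hxf
          subst hxr
          refine ⟨p0 ++ r.output ++ q0, by simp, ?_, hd.tail ⟨r, hr, ?_⟩⟩
          · intro y hy
            simp only [List.mem_append] at hy
            rcases hy with (hy | hy) | hy
            · exact hS y (by simp [hy])
            · exact Or.inr ⟨r, hr, Or.inr hy⟩
            · exact hS y (by simp [hy])
          · rw [← List.append_assoc]
            exact r.rewrites_of_exists_parts p0 q0
    obtain ⟨u, hu, -, hd⟩ := key _ h
    rw [hterm' w u hu] at hd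
    exact hd
  · intro h
    have key : ∀ u, g.Derives [Symbol.nonterminal g.initial] u →
        Relation.ReflTransGen R [Symbol.nonterminal (f g.initial)] (u.map F) := by
      intro u hu
      induction hu with
      | refl => exact Relation.ReflTransGen.refl
      | tail _ hp ih =>
        obtain ⟨r, hr, hrw⟩ := hp
        obtain ⟨p, q, rfl, rfl⟩ := hrw.exists_parts
        refine ih.tail ⟨⟨f r.input, r.output.map F⟩, (hrules _).2 ⟨r, hr, rfl⟩, ?_⟩
        simp only [List.map_append, List.map_cons, List.map_nil, hF_nt]
        exact ContextFreeRule.rewrites_of_exists_parts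
          (⟨f r.input, r.output.map F⟩ : ContextFreeRule α ℕ) (p.map F) (q.map F)
    have := key _ h
    rw [hterm] at this
    exact this

/-- Nonempty words over an effectively coded alphabet are effectively coded, as words. -/
instance NonemptyWord.primcodable [Primcodable α] : Primcodable (NonemptyWord α) :=
  Primcodable.subtype (p := fun v : List α => v ≠ [])
    (PrimrecPred.not (PrimrecPred.comp (p := fun n : ℕ => n = 0)
      (Primrec.eq.comp Primrec.id (Primrec.const 0)) Primrec.list_length |>.of_eq
        fun _ => List.length_eq_zero_iff))

end OmegaLang

end

namespace OmegaLang

universe u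

variable {α : Type u}

open Stream'

/-! Finiteness of `K v^ω` is shown to be semidecidable, and so is its negation.

Suppose `K v^ω` is finite. Its members then have only finitely many suffixes, and this makes pumping
invisible: if `xⁿ w yⁿ z` stays in a finite suffix-closed set for all `n`, the pigeonhole principle
gives `y z = z` and then `x w z = w z` (`pumped_one_append_stream_eq`). A nonterminal repeated on a
path of a parse tree can therefore be cut out without changing the ω-word, so every member comes
from a tree of height at most the number of productions (`Derivation.exists_mem_yields`). Hence
`shortWords` lists all members, and a derivable word whose ω-word is missing from that list
witnesses infiniteness.

For the positive side, let words act on a finite suffix-closed set `Q` of ω-words by prepending, as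
partial maps. There are finitely many actions, and concatenation composes them. So once height `n +
1` yields no new pair of nonterminal and action beyond height `n`, no greater height does
(`exists_agree_of_mem_yields`). The data `Q` and `n` form a checkable certificate; certificates
imply finiteness (`finite_of_isCertificate`) and exist whenever the set is finite
(`exists_isCertificate`). -/

theorem append_stream_cancel (u : List α) {s t : Stream' α} (h : u ++ₛ s = u ++ₛ t) : s = t := by
  rw [← drop_append_stream u s, h, drop_append_stream]

/-- Letters inside the prefix `y` are prescribed, and every later letter equals the one `|y|` places
earlier. -/
theorem eq_of_append_stream_fixed {y : List α} (hy : y ≠ []) {s t : Stream' α}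
    (hs : y ++ₛ s = s) (ht : y ++ₛ t = t) : s = t := by
  ext n
  induction n using Nat.strong_induction_on with
  | _ n ih =>
    have hpos : 0 < y.length := List.length_pos_iff.2 hy
    rw [← hs, ← ht]
    by_cases hn : n < y.length
    · rw [get_append_left n y s hn, get_append_left n y t hn]
    · obtain ⟨m, rfl⟩ := Nat.exists_eq_add_of_le (not_lt.1 hn)
      rw [get_append_right, get_append_right]
      exact ih m (by omega)

theorem iterate_append_stream (y : List α) (z : Stream' α) (n : ℕ) :
    (y ++ₛ ·)^[n] z = (List.replicate n y).flatten ++ₛ z := by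
  induction n with
  | zero => simp
  | succ n ih => rw [Function.iterate_succ_apply', ih, List.replicate_succ, List.flatten_cons,
      append_append_stream]

theorem append_stream_eq_self_of_finite {Q : Set (Stream' α)} (hQ : Q.Finite) {y : List α}
    {z : Stream' α} (h : ∀ n, (y ++ₛ ·)^[n] z ∈ Q) : y ++ₛ z = z := by
  rcases eq_or_ne y [] with rfl | hy
  · simp
  obtain ⟨i, j, hij, he⟩ := hQ.exists_lt_map_eq_of_forall_mem h
  obtain ⟨k, rfl⟩ := Nat.exists_eq_add_of_lt hij
  rw [add_assoc, Function.iterate_add_apply] at he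
  have hz := Function.Injective.iterate (f := (y ++ₛ ·)) (fun _ _ => append_stream_cancel y) i he
  have hne : (List.replicate (k + 1) y).flatten ≠ [] := by
    simp [List.replicate_succ, hy]
  -- Cancelling `y^i` left `z = y^(k+1) z`; hence `y z` and `z` are both fixed by the nonempty
  -- prefix `y^(k+1)`.
  refine eq_of_append_stream_fixed hne ?_ ?_
  · rw [← iterate_append_stream, ← Function.iterate_succ_apply (y ++ₛ ·),
      Function.iterate_succ_apply' (y ++ₛ ·), ← hz]
  · rw [← iterate_append_stream, ← hz]

/-- The word `xⁿ w yⁿ`. -/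
def pumped (x w y : List α) : ℕ → List α
  | 0 => w
  | n + 1 => x ++ pumped x w y n ++ y

theorem pumped_append_stream (x w y : List α) (n : ℕ) (z : Stream' α) :
    pumped x w y n ++ₛ z = (x ++ₛ ·)^[n] (w ++ₛ (y ++ₛ ·)^[n] z) := by
  induction n generalizing z with
  | zero => rfl
  | succ n ih =>
    rw [pumped, append_append_stream, append_append_stream, ih, Function.iterate_succ_apply',
      Function.iterate_succ_apply (y ++ₛ ·)]

/-- A set of `ω`-words that contains every suffix of each of its members. -/
def SuffixClosed (Q : Set (Stream' α)) : Prop :=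
  ∀ (u : List α) (t : Stream' α), u ++ₛ t ∈ Q → t ∈ Q

theorem mem_of_iterate_append_stream_mem {Q : Set (Stream' α)}
    (hs : SuffixClosed Q) (x : List α) (n : ℕ)
    {t : Stream' α} (h : (x ++ₛ ·)^[n] t ∈ Q) : t ∈ Q := by
  rw [iterate_append_stream] at h
  exact hs _ _ h

/-- If all pumped words lie, before `z`, in a finite suffix-closed set, pumping has no effect. -/
theorem pumped_one_append_stream_eq {Q : Set (Stream' α)} (hQ : Q.Finite)
    (hs : SuffixClosed Q) {x w y : List α} {z : Stream' α}
    (h : ∀ n, pumped x w y n ++ₛ z ∈ Q) : x ++ w ++ y ++ₛ z = w ++ₛ z := by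
  -- Suffix closure strips `xⁿ w`, so all `yⁿ z` lie in `Q`. Once `y` fixes `z`, the right-hand
  -- copies vanish and the same argument applies to `x` and `w z`.
  have hy : y ++ₛ z = z := append_stream_eq_self_of_finite hQ fun n => by
    have := h n
    rw [pumped_append_stream] at this
    exact hs _ _ (mem_of_iterate_append_stream_mem hs _ _ this)
  have hx : x ++ₛ (w ++ₛ z) = w ++ₛ z := append_stream_eq_self_of_finite hQ fun n => by
    have := h n
    rwa [pumped_append_stream, Function.iterate_fixed (f := (y ++ₛ ·)) hy] at this
  rw [append_append_stream, append_append_stream, hy, hx]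

/-! ### Suffixes of ω-words with period `v` -/

theorem omegaPow_eq (v : NonemptyWord α) : omegaPow v = v.1 ++ₛ omegaPow v :=
  Stream'.cycle_eq v.1 v.2

theorem length_pos (v : NonemptyWord α) : 0 < v.1.length := List.length_pos_iff.2 v.2

theorem drop_add_length (u : List α) (v : NonemptyWord α) {k : ℕ} (hk : u.length ≤ k) :
    (u ++ₛ omegaPow v).drop (k + v.1.length) = (u ++ₛ omegaPow v).drop k := by
  obtain ⟨m, rfl⟩ := Nat.exists_eq_add_of_le hk
  have h1 : ∀ j, (u ++ₛ omegaPow v).drop (u.length + j) = (omegaPow v).drop j := fun j => by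
    conv_rhs => rw [← drop_append_stream u (omegaPow v)]
    rw [Stream'.drop_drop]
  have h2 : (omegaPow v).drop v.1.length = omegaPow v := by
    conv_lhs => rw [omegaPow_eq]
    exact drop_append_stream _ _
  rw [add_assoc, h1, h1, add_comm m, ← Stream'.drop_drop, h2]

theorem finite_range_drop (u : List α) (v : NonemptyWord α) :
    (Set.range fun k => (u ++ₛ omegaPow v).drop k).Finite := by
  refine ((Set.finite_Iio (u.length + v.1.length)).image
    fun k => (u ++ₛ omegaPow v).drop k).subset ?_
  rintro _ ⟨k, rfl⟩
  induction k using Nat.strong_induction_on with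
  | _ k ih =>
    by_cases hk : k < u.length + v.1.length
    · exact ⟨k, hk, rfl⟩
    · obtain ⟨m, rfl⟩ := Nat.exists_eq_add_of_le' (show v.1.length ≤ k by omega)
      have := length_pos v
      simp only [drop_add_length u v (show u.length ≤ m by omega)]
      exact ih m (by omega)

/-- The set of suffixes of the members of a set of `ω`-words. -/
def suffixes (F : Set (Stream' α)) : Set (Stream' α) := {t | ∃ u : List α, u ++ₛ t ∈ F}

theorem subset_suffixes (F : Set (Stream' α)) : F ⊆ suffixes F := fun _ h => ⟨[], h⟩

theorem suffixClosed_suffixes (F : Set (Stream' α)) : SuffixClosed (suffixes F) := by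
  rintro u t ⟨w, hw⟩
  exact ⟨w ++ u, by rwa [append_append_stream]⟩

/-- A suffix may begin inside the periodic part. Unrolling `|x|` copies of `v` into the finite
prefix makes that prefix at least as long as the removed word `x`. -/
theorem exists_eq_append_of_mem_suffixes {F : Set (Stream' α)} {v : NonemptyWord α}
    (hF : ∀ z ∈ F, ∃ u : List α, z = u ++ₛ omegaPow v) {t : Stream' α} (ht : t ∈ suffixes F) :
    ∃ u : List α, t = u ++ₛ omegaPow v := by
  obtain ⟨x, hx⟩ := ht
  obtain ⟨u, hu⟩ := hF _ hx
  have hiter : omegaPow v = (List.replicate x.length v.1).flatten ++ₛ omegaPow v := by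
    rw [← iterate_append_stream, Function.iterate_fixed (omegaPow_eq v).symm]
  have hlen : x.length ≤ (u ++ (List.replicate x.length v.1).flatten).length := by
    have := Nat.mul_le_mul_left x.length (length_pos v)
    simp only [List.length_append, List.length_flatten, List.map_replicate, List.sum_replicate,
      smul_eq_mul]
    omega
  rw [hiter, ← append_append_stream] at hu
  generalize u ++ (List.replicate x.length v.1).flatten = y at hu hlen
  refine ⟨y.drop x.length, ?_⟩
  have h2 : (y.take x.length).length = x.length := by simpa using hlen
  rw [← drop_append_stream x t, hu, ← drop_append_stream (y.take x.length) (y.drop x.length ++ₛ _),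
    ← append_append_stream, List.take_append_drop, h2]

theorem finite_suffixes {F : Set (Stream' α)} (hfin : F.Finite) {v : NonemptyWord α}
    (hF : ∀ z ∈ F, ∃ u : List α, z = u ++ₛ omegaPow v) : (suffixes F).Finite := by
  have : suffixes F ⊆ ⋃ z ∈ F, Set.range fun k => z.drop k := by
    rintro t ⟨u, hu⟩
    exact Set.mem_biUnion hu ⟨u.length, drop_append_stream u t⟩
  refine Set.Finite.subset (hfin.biUnion fun z hz => ?_) this
  obtain ⟨u, rfl⟩ := hF z hz
  exact finite_range_drop u v

/-! ### Equality of ω-words with period `v` as a finite check -/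

/-- The letter of `u v^ω` at position `n`. -/
def letter (v u : List α) (n : ℕ) : Option α :=
  if n < u.length then u[n]? else v[(n - u.length) % v.length]?

theorem get_omegaPow (v : NonemptyWord α) (n : ℕ) :
    v.1[n % v.1.length]? = some ((omegaPow v).get n) := by
  induction n using Nat.strong_induction_on with
  | _ n ih =>
    have hv := length_pos v
    rw [omegaPow_eq]
    by_cases hn : n < v.1.length
    · rw [get_append_left n _ _ hn, Nat.mod_eq_of_lt hn, List.getElem?_eq_getElem hn]
    · obtain ⟨m, rfl⟩ := Nat.exists_eq_add_of_le (not_lt.1 hn)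
      rw [get_append_right, Nat.add_mod_left]
      exact ih m (by omega)

theorem letter_eq (v : NonemptyWord α) (u : List α) (n : ℕ) :
    letter v.1 u n = some ((u ++ₛ omegaPow v).get n) := by
  unfold letter
  split_ifs with hn
  · rw [get_append_left n _ _ hn, List.getElem?_eq_getElem hn]
  · obtain ⟨m, rfl⟩ := Nat.exists_eq_add_of_le (not_lt.1 hn)
    rw [get_append_right, Nat.add_sub_cancel_left, get_omegaPow]

theorem get_add_length (u : List α) (v : NonemptyWord α) {n : ℕ} (hn : u.length ≤ n) :
    (u ++ₛ omegaPow v).get (n + v.1.length) = (u ++ₛ omegaPow v).get n := by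
  have := congrArg (fun s => s.get 0) (drop_add_length u v hn)
  simpa [Stream'.get_drop] using this

/-- `u v^ω = u' v^ω`, as a bounded comparison of letters. -/
def SameTail (v u u' : List α) : Prop :=
  ∀ n < u.length + u'.length + v.length, letter v u n = letter v u' n

/-- Beyond the bound, stepping back by `|v|` still lands past both `u` and `u'`, where both ω-words
have period `|v|`. -/
theorem sameTail_iff (v : NonemptyWord α) (u u' : List α) :
    SameTail v.1 u u' ↔ u ++ₛ omegaPow v = u' ++ₛ omegaPow v := by
  constructor
  · intro h
    ext n
    induction n using Nat.strong_induction_on with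
    | _ n ih =>
      by_cases hn : n < u.length + u'.length + v.1.length
      · simpa [letter_eq] using h n hn
      · obtain ⟨m, rfl⟩ := Nat.exists_eq_add_of_le' (show v.1.length ≤ n by omega)
        have := length_pos v
        rw [get_add_length u v (by omega), get_add_length u' v (by omega)]
        exact ih m (by omega)
  · intro h n _
    rw [letter_eq, letter_eq, h]

/-! ### Parse forests counted by inner nodes -/

/-- `Derivation R Xs w n`: the sentential form `Xs` derives the terminal word `w` by a forest of
parse trees with `n` inner nodes, for the list `R` of productions. -/
inductive Derivation (R : List (ℕ × List (ℕ ⊕ α))) : List (ℕ ⊕ α) → List α → ℕ → Prop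
  | nil : Derivation R [] [] 0
  | terminal (a : α) {Xs w n} : Derivation R Xs w n → Derivation R (Sum.inr a :: Xs) (a :: w) n
  | nonterminal {A rhs w n Xs w' m} : (A, rhs) ∈ R → Derivation R rhs w n → Derivation R Xs w' m →
      Derivation R (Sum.inl A :: Xs) (w ++ w') (n + 1 + m)

variable {R : List (ℕ × List (ℕ ⊕ α))}

namespace Derivation

theorem append {Xs Ys : List (ℕ ⊕ α)} {w w' : List α} {n m : ℕ} (h : Derivation R Xs w n)
    (h' : Derivation R Ys w' m) : Derivation R (Xs ++ Ys) (w ++ w') (n + m) := by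
  induction h with
  | nil => simpa using h'
  | terminal a _ ih => exact ih.terminal a
  | nonterminal hr h1 _ _ ih =>
    rw [List.append_assoc, add_assoc]
    exact nonterminal hr h1 ih

theorem exists_of_append {Xs Ys : List (ℕ ⊕ α)} {w : List α} {n : ℕ}
    (h : Derivation R (Xs ++ Ys) w n) : ∃ w₁ w₂ n₁ n₂, Derivation R Xs w₁ n₁ ∧
      Derivation R Ys w₂ n₂ ∧ w = w₁ ++ w₂ := by
  induction Xs generalizing w n with
  | nil => exact ⟨[], w, 0, n, nil, h, rfl⟩
  | cons X Xs ih =>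
    cases h with
    | terminal a h =>
      obtain ⟨w₁, w₂, n₁, n₂, h₁, h₂, rfl⟩ := ih h
      exact ⟨_, _, _, _, h₁.terminal a, h₂, rfl⟩
    | nonterminal hr h1 h =>
      obtain ⟨w₁, w₂, n₁, n₂, h₁, h₂, rfl⟩ := ih h
      exact ⟨_, _, _, _, nonterminal hr h1 h₁, h₂, (List.append_assoc _ _ _).symm⟩

theorem of_rule {A : ℕ} {rhs : List (ℕ ⊕ α)} {w : List α} {n : ℕ} (hr : (A, rhs) ∈ R)
    (h : Derivation R rhs w n) : Derivation R [Sum.inl A] w (n + 1) := by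
  simpa using nonterminal hr h nil

theorem map_inr (w : List α) : Derivation R (w.map Sum.inr) w 0 := by
  induction w with
  | nil => exact nil
  | cons a w ih => exact ih.terminal a

end Derivation

/-! ### Agreement with derivations of context-free grammars -/

theorem toSymbol_injective : Function.Injective (toSymbol : ℕ ⊕ α → Symbol α ℕ) := by
  rintro (a | a) (b | b) h <;> simp_all [toSymbol]

theorem mem_rules_iff {c : GrammarCode α} {r : ContextFreeRule α ℕ} :
    r ∈ GrammarCode.rules c ↔ ∃ p ∈ c.2, (⟨p.1, p.2.map toSymbol⟩ : ContextFreeRule α ℕ) = r := by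
  simp [GrammarCode.rules]

theorem Derivation.derives {c : GrammarCode α} {Xs : List (ℕ ⊕ α)} {w : List α} {n : ℕ}
    (h : Derivation c.2 Xs w n) :
    (GrammarCode.toGrammar c).Derives (Xs.map toSymbol) (w.map Symbol.terminal) := by
  induction h with
  | nil => exact ContextFreeGrammar.Derives.refl _
  | terminal a _ ih =>
    exact ih.append_left [Symbol.terminal a]
  | @nonterminal A rhs w n Xs w' m hr _ _ ih1 ih2 =>
    have h1 : (GrammarCode.toGrammar c).Produces ((Sum.inl A :: Xs).map toSymbol)
        (rhs.map toSymbol ++ Xs.map toSymbol) :=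
      ⟨⟨A, rhs.map toSymbol⟩, mem_rules_iff.2 ⟨_, hr, rfl⟩,
        ContextFreeRule.Rewrites.head _⟩
    rw [List.map_append]
    exact h1.trans_derives ((ih1.append_right _).trans (ih2.append_left _))

/-- Rewriting steps are undone starting from the terminal word: each one splits the forest around
the right-hand side and grafts a new node above the middle part. -/
theorem exists_derivation {c : GrammarCode α} {w : List α} {s : List (Symbol α ℕ)}
    (h : (GrammarCode.toGrammar c).Derives s (w.map Symbol.terminal)) :
    ∃ (Xs : List (ℕ ⊕ α)) (n : ℕ), s = Xs.map toSymbol ∧ Derivation c.2 Xs w n := by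
  induction h using Relation.ReflTransGen.head_induction_on with
  | refl =>
    refine ⟨w.map Sum.inr, 0, ?_, Derivation.map_inr w⟩
    rw [List.map_map]
    rfl
  | head hp _ ih =>
    obtain ⟨Ys, n, rfl, hd⟩ := ih
    obtain ⟨r, hr, hrw⟩ := hp
    obtain ⟨⟨A, rhs⟩, hmem, rfl⟩ := mem_rules_iff.1 hr
    obtain ⟨p, q, rfl, hq⟩ := hrw.exists_parts
    obtain ⟨l, q, rfl, hl, rfl⟩ := List.map_eq_append_iff.1 hq
    obtain ⟨p, rhs', rfl, rfl, hrhs⟩ := List.map_eq_append_iff.1 hl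
    obtain rfl := (List.map_injective_iff.2 toSymbol_injective) hrhs
    obtain ⟨w₁, w₂, n₁, n₂, h₁, h₂, rfl⟩ := hd.exists_of_append
    obtain ⟨w₀, w₃, n₀, n₃, h₀, h₃, rfl⟩ := h₁.exists_of_append
    exact ⟨p ++ [Sum.inl A] ++ q, _, by rw [List.map_append, List.map_append]; rfl,
      (h₀.append (Derivation.of_rule hmem h₃)).append h₂⟩

theorem mem_language_iff_derivation {c : GrammarCode α} {w : List α} :
    w ∈ GrammarCode.language c ↔ ∃ n, Derivation c.2 [Sum.inl c.1] w n := by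
  constructor
  · intro h
    obtain ⟨Xs, n, hXs, hd⟩ := exists_derivation (c := c) (w := w) h
    obtain rfl : [Sum.inl c.1] = Xs := List.map_injective_iff.2 toSymbol_injective hXs
    exact ⟨n, hd⟩
  · rintro ⟨n, h⟩
    exact h.derives

/-! ### Yields of parse trees of bounded height -/

/-- The words obtained by prepending to `w` a word for the symbol `X`, where `Y` lists words for
nonterminals. -/
def prepend (Y : List (ℕ × List α)) (X : ℕ ⊕ α) (w : List α) : List (List α) :=
  Sum.casesOn X (fun B => Y.flatMap fun t => if t.1 = B then [t.2 ++ w] else []) fun a => [a :: w]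

/-- The words obtained from `Xs` by replacing each nonterminal by a word that `Y` lists for it. -/
def substitutions (Y : List (ℕ × List α)) (Xs : List (ℕ ⊕ α)) : List (List α) :=
  Xs.foldr (fun X S => S.flatMap (prepend Y X)) [[]]

/-- The pairs of a nonterminal and the yield of a parse tree for it of height at most `n`. -/
def yields (R : List (ℕ × List (ℕ ⊕ α))) (n : ℕ) : List (ℕ × List α) :=
  (fun Y => R.flatMap fun r => (substitutions Y r.2).map fun w => (r.1, w))^[n] []

theorem mem_substitutions_nil {Y : List (ℕ × List α)} {w : List α} :
    w ∈ substitutions Y [] ↔ w = [] := by simp [substitutions]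

theorem mem_substitutions_terminal {Y : List (ℕ × List α)} {a : α} {Xs : List (ℕ ⊕ α)}
    {w : List α} : w ∈ substitutions Y (Sum.inr a :: Xs) ↔
      ∃ w' ∈ substitutions Y Xs, w = a :: w' := by
  simp [substitutions, prepend]

theorem mem_substitutions_nonterminal {Y : List (ℕ × List α)} {A : ℕ} {Xs : List (ℕ ⊕ α)}
    {w : List α} : w ∈ substitutions Y (Sum.inl A :: Xs) ↔
      ∃ w₁ w₂, (A, w₁) ∈ Y ∧ w₂ ∈ substitutions Y Xs ∧ w = w₁ ++ w₂ := by
  simp only [substitutions, prepend, List.foldr_cons, List.mem_flatMap]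
  constructor
  · rintro ⟨w₂, h₂, ⟨B, w₁⟩, h₁, h⟩
    split_ifs at h with hB
    · subst hB
      exact ⟨w₁, w₂, h₁, h₂, by simpa using h⟩
    · simp at h
  · rintro ⟨w₁, w₂, h₁, h₂, rfl⟩
    exact ⟨w₂, h₂, (A, w₁), h₁, by simp⟩

theorem mem_substitutions_singleton {Y : List (ℕ × List α)} {A : ℕ} {w : List α} :
    w ∈ substitutions Y [Sum.inl A] ↔ (A, w) ∈ Y := by
  simp [mem_substitutions_nonterminal, mem_substitutions_nil]

theorem yields_zero : yields R 0 = [] := rfl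

theorem mem_yields_succ {n A : ℕ} {w : List α} :
    (A, w) ∈ yields R (n + 1) ↔ ∃ rhs, (A, rhs) ∈ R ∧ w ∈ substitutions (yields R n) rhs := by
  rw [yields, Function.iterate_succ_apply', ← yields]
  simp only [List.mem_flatMap, List.mem_map, Prod.mk.injEq, Prod.exists]
  constructor
  · rintro ⟨B, rhs, h, w', hw, rfl, rfl⟩
    exact ⟨rhs, h, hw⟩
  · rintro ⟨rhs, h, hw⟩
    exact ⟨A, rhs, h, w, hw, rfl, rfl⟩

theorem substitutions_subset {Y Y' : List (ℕ × List α)} (h : Y ⊆ Y') (Xs : List (ℕ ⊕ α)) :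
    substitutions Y Xs ⊆ substitutions Y' Xs := by
  induction Xs with
  | nil => exact fun _ h => h
  | cons X Xs ih =>
    intro w
    rcases X with A | a
    · simp only [mem_substitutions_nonterminal]
      rintro ⟨w₁, w₂, h₁, h₂, rfl⟩
      exact ⟨w₁, w₂, h h₁, ih h₂, rfl⟩
    · simp only [mem_substitutions_terminal]
      rintro ⟨w', h', rfl⟩
      exact ⟨w', ih h', rfl⟩

theorem yields_subset_succ (n : ℕ) : yields R n ⊆ yields R (n + 1) := by
  induction n with
  | zero => simp [yields_zero]
  | succ n ih =>
    rintro ⟨A, w⟩ h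
    rw [mem_yields_succ] at h ⊢
    exact h.imp fun rhs h => ⟨h.1, substitutions_subset ih _ h.2⟩

theorem yields_subset {n m : ℕ} (h : n ≤ m) : yields R n ⊆ yields R m := by
  induction h with
  | refl => exact fun _ h => h
  | step _ ih => exact fun _ h => yields_subset_succ _ (ih h)

theorem exists_derivation_of_mem_substitutions {n : ℕ} {Xs : List (ℕ ⊕ α)} {w : List α}
    (h : w ∈ substitutions (yields R n) Xs) : ∃ m, Derivation R Xs w m := by
  induction n generalizing Xs w with
  | zero =>
    induction Xs generalizing w with
    | nil => exact ⟨0, by rw [mem_substitutions_nil.1 h]; exact Derivation.nil⟩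
    | cons X Xs ih =>
      rcases X with A | a
      · simp [mem_substitutions_nonterminal, yields_zero] at h
      · obtain ⟨w', h', rfl⟩ := mem_substitutions_terminal.1 h
        exact (ih h').imp fun m hm => hm.terminal a
  | succ n ihn =>
    induction Xs generalizing w with
    | nil => exact ⟨0, by rw [mem_substitutions_nil.1 h]; exact Derivation.nil⟩
    | cons X Xs ih =>
      rcases X with A | a
      · obtain ⟨w₁, w₂, h₁, h₂, rfl⟩ := mem_substitutions_nonterminal.1 h
        obtain ⟨rhs, hr, h₁⟩ := mem_yields_succ.1 h₁
        obtain ⟨m₁, h₁⟩ := ihn h₁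
        obtain ⟨m₂, h₂⟩ := ih h₂
        exact ⟨_, Derivation.nonterminal hr h₁ h₂⟩
      · obtain ⟨w', h', rfl⟩ := mem_substitutions_terminal.1 h
        exact (ih h').imp fun m hm => hm.terminal a

theorem Derivation.exists_mem_substitutions {Xs : List (ℕ ⊕ α)} {w : List α} {m : ℕ}
    (h : Derivation R Xs w m) : ∃ n, w ∈ substitutions (yields R n) Xs := by
  induction h with
  | nil => exact ⟨0, mem_substitutions_nil.2 rfl⟩
  | terminal a _ ih => exact ih.imp fun n hn => mem_substitutions_terminal.2 ⟨_, hn, rfl⟩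
  | nonterminal hr _ _ ih₁ ih₂ =>
    obtain ⟨n₁, h₁⟩ := ih₁
    obtain ⟨n₂, h₂⟩ := ih₂
    -- The production used at the first symbol adds one level to its own tree only.
    refine ⟨max (n₁ + 1) n₂, mem_substitutions_nonterminal.2 ⟨_, _, ?_, ?_, rfl⟩⟩
    · exact yields_subset (le_max_left _ _) (mem_yields_succ.2 ⟨_, hr, h₁⟩)
    · exact substitutions_subset (yields_subset (le_max_right _ _)) _ h₂

theorem mem_language_iff_yields {c : GrammarCode α} {w : List α} :
    w ∈ GrammarCode.language c ↔ ∃ n, (c.1, w) ∈ yields c.2 n := by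
  rw [mem_language_iff_derivation]
  constructor
  · rintro ⟨m, h⟩
    exact h.exists_mem_substitutions.imp fun n hn => mem_substitutions_singleton.1 hn
  · rintro ⟨n, h⟩
    exact exists_derivation_of_mem_substitutions (mem_substitutions_singleton.2 h)

/-! ### Pumping -/

/-- `Context R Xs A x y k`: any parse tree for `A` extends to a forest for `Xs` with `k` additional
inner nodes and the additional words `x` and `y` on the left and on the right. -/
def Context (R : List (ℕ × List (ℕ ⊕ α))) (Xs : List (ℕ ⊕ α)) (A : ℕ) (x y : List α) (k : ℕ) :
    Prop :=
  ∀ ⦃w : List α⦄ ⦃m : ℕ⦄, Derivation R [Sum.inl A] w m → Derivation R Xs (x ++ w ++ y) (k + m)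

namespace Context

theorem append_left {Xs Ys : List (ℕ ⊕ α)} {A : ℕ} {x y w : List α} {k n : ℕ}
    (h : Context R Xs A x y k) (hw : Derivation R Ys w n) :
    Context R (Ys ++ Xs) A (w ++ x) y (n + k) := fun u m hu => by
  simpa [add_assoc] using hw.append (h hu)

theorem append_right {Xs Ys : List (ℕ ⊕ α)} {A : ℕ} {x y w : List α} {k n : ℕ}
    (h : Context R Xs A x y k) (hw : Derivation R Ys w n) :
    Context R (Xs ++ Ys) A x (y ++ w) (k + n) := fun u m hu => by
  have := (h hu).append hw
  rw [add_right_comm] at this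
  simpa using this

theorem of_rule {B : ℕ} {rhs : List (ℕ ⊕ α)} {A : ℕ} {x y : List α} {k : ℕ} (hr : (B, rhs) ∈ R)
    (h : Context R rhs A x y k) : Context R [Sum.inl B] A x y (k + 1) := fun u m hu => by
  rw [add_right_comm]
  exact Derivation.of_rule hr (h hu)

theorem refl (A : ℕ) : Context R [Sum.inl A] A [] [] 0 := fun u m hu => by simpa using hu

end Context

theorem Context.exists_derivation_pumped {A : ℕ} {x y w : List α} {k m : ℕ}
    (h : Context R [Sum.inl A] A x y k) (hw : Derivation R [Sum.inl A] w m) (i : ℕ) :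
    ∃ m', Derivation R [Sum.inl A] (pumped x w y i) m' := by
  induction i with
  | zero => exact ⟨m, hw⟩
  | succ i ih =>
    obtain ⟨m', hm'⟩ := ih
    exact ⟨_, h hm'⟩

/-- The word `w` with a forest of size `n` for `Xs` contains a subtree for a nonterminal in `P`. -/
def HasSubtree (R : List (ℕ × List (ℕ ⊕ α))) (P : Finset ℕ) (Xs : List (ℕ ⊕ α)) (w : List α)
    (n : ℕ) : Prop :=
  ∃ A ∈ P, ∃ x y k u m, Context R Xs A x y k ∧ Derivation R [Sum.inl A] u m ∧
    w = x ++ u ++ y ∧ n = k + m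

/-- The word `w` with a forest of size `n` for `Xs` contains a nonempty pumping pair. -/
def HasPump (R : List (ℕ × List (ℕ ⊕ α))) (Xs : List (ℕ ⊕ α)) (w : List α) (n : ℕ) : Prop :=
  ∃ A p q k x y l u m, Context R Xs A p q k ∧ Context R [Sum.inl A] A x y l ∧ 0 < l ∧
    Derivation R [Sum.inl A] u m ∧ w = p ++ (x ++ u ++ y) ++ q ∧ n = k + (l + m)

theorem HasSubtree.append_left {P : Finset ℕ} {Xs Ys : List (ℕ ⊕ α)} {w w' : List α} {n n' : ℕ}
    (h : HasSubtree R P Xs w n) (hw : Derivation R Ys w' n') :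
    HasSubtree R P (Ys ++ Xs) (w' ++ w) (n' + n) := by
  obtain ⟨A, hA, x, y, k, u, m, hc, hu, rfl, rfl⟩ := h
  exact ⟨A, hA, _, _, _, u, m, hc.append_left hw, hu, by simp, by omega⟩

theorem HasSubtree.append_right {P : Finset ℕ} {Xs Ys : List (ℕ ⊕ α)} {w w' : List α} {n n' : ℕ}
    (h : HasSubtree R P Xs w n) (hw : Derivation R Ys w' n') :
    HasSubtree R P (Xs ++ Ys) (w ++ w') (n + n') := by
  obtain ⟨A, hA, x, y, k, u, m, hc, hu, rfl, rfl⟩ := h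
  exact ⟨A, hA, _, _, _, u, m, hc.append_right hw, hu, by simp, by omega⟩

theorem HasPump.append_left {Xs Ys : List (ℕ ⊕ α)} {w w' : List α} {n n' : ℕ}
    (h : HasPump R Xs w n) (hw : Derivation R Ys w' n') :
    HasPump R (Ys ++ Xs) (w' ++ w) (n' + n) := by
  obtain ⟨A, p, q, k, x, y, l, u, m, hc, hl, hpos, hu, rfl, rfl⟩ := h
  exact ⟨A, _, _, _, x, y, l, u, m, hc.append_left hw, hl, hpos, hu, by simp, by omega⟩

theorem HasPump.append_right {Xs Ys : List (ℕ ⊕ α)} {w w' : List α} {n n' : ℕ}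
    (h : HasPump R Xs w n) (hw : Derivation R Ys w' n') :
    HasPump R (Xs ++ Ys) (w ++ w') (n + n') := by
  obtain ⟨A, p, q, k, x, y, l, u, m, hc, hl, hpos, hu, rfl, rfl⟩ := h
  exact ⟨A, _, _, _, x, y, l, u, m, hc.append_right hw, hl, hpos, hu, by simp, by omega⟩

theorem HasPump.of_rule {A : ℕ} {rhs : List (ℕ ⊕ α)} {w : List α} {n : ℕ} (hr : (A, rhs) ∈ R)
    (h : HasPump R rhs w n) : HasPump R [Sum.inl A] w (n + 1) := by
  obtain ⟨A, p, q, k, x, y, l, u, m, hc, hl, hpos, hu, rfl, rfl⟩ := h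
  exact ⟨A, _, _, _, x, y, l, u, m, hc.of_rule hr, hl, hpos, hu, by simp, by omega⟩

/-- The nonterminals that have productions. -/
def heads (R : List (ℕ × List (ℕ ⊕ α))) : Finset ℕ := (R.map Prod.fst).toFinset

/-- `P` holds the nonterminals already met on the path from the root. Each descent through a fresh
nonterminal adds it to `P` and uses up one unit of height; meeting an element of `P` again closes a
pump at the ancestor carrying it. -/
theorem Derivation.short_or_pump {Xs : List (ℕ ⊕ α)} {w : List α} {n : ℕ}
    (hd : Derivation R Xs w n) (P : Finset ℕ) (h : ℕ) (hP : (heads R \ P).card ≤ h) :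
    w ∈ substitutions (yields R h) Xs ∨ HasSubtree R P Xs w n ∨ HasPump R Xs w n := by
  induction hd generalizing P h with
  | nil => exact Or.inl (mem_substitutions_nil.2 rfl)
  | @terminal a Xs w n hd ih =>
    have ha : Derivation R [Sum.inr a] [a] 0 := Derivation.nil.terminal a
    rcases ih P h hP with ih | ih | ih
    · exact Or.inl (mem_substitutions_terminal.2 ⟨_, ih, rfl⟩)
    · exact Or.inr (Or.inl (by simpa using ih.append_left ha))
    · exact Or.inr (Or.inr (by simpa using ih.append_left ha))
  | @nonterminal A rhs w n Xs w' m hr hd hd' ih ih' =>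
    have hA : Derivation R [Sum.inl A] w (n + 1) := Derivation.of_rule hr hd
    by_cases hAP : A ∈ P
    · exact Or.inr (Or.inl ⟨A, hAP, [], w', m, w, n + 1,
        by simpa using (Context.refl A).append_right hd', hA, by simp, by omega⟩)
    have hAh : A ∈ heads R := List.mem_toFinset.2 (List.mem_map.2 ⟨_, hr, rfl⟩)
    have hcard : (heads R \ insert A P).card + 1 = (heads R \ P).card := by
      rw [Finset.sdiff_insert]
      exact Finset.card_erase_add_one (Finset.mem_sdiff.2 ⟨hAh, hAP⟩)
    -- The head `A` lies outside `P`, so the count bounded by `h` is positive.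
    obtain ⟨h, rfl⟩ : ∃ h', h = h' + 1 := ⟨h - 1, by omega⟩
    rcases ih (insert A P) h (by omega) with ih | ih | ih
    · have hw : (A, w) ∈ yields R (h + 1) := mem_yields_succ.2 ⟨_, hr, ih⟩
      rcases ih' P (h + 1) hP with ih' | ih' | ih'
      · exact Or.inl (mem_substitutions_nonterminal.2 ⟨_, _, hw, ih', rfl⟩)
      · exact Or.inr (Or.inl (ih'.append_left hA))
      · exact Or.inr (Or.inr (ih'.append_left hA))
    · obtain ⟨B, hB, x, y, k, u, l, hc, hu, rfl, rfl⟩ := ih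
      rcases Finset.mem_insert.1 hB with rfl | hB
      -- The repeated nonterminal is `A` itself. Its production is part of the loop, so the loop has
      -- `k + 1 > 0` inner nodes even when `x` and `y` are empty.
      · refine Or.inr (Or.inr (HasPump.append_right (Xs := [Sum.inl B]) ?_ hd'))
        exact ⟨B, [], [], 0, x, y, k + 1, u, l, Context.refl B, hc.of_rule hr, by omega, hu,
          by simp, by omega⟩
      · refine Or.inr (Or.inl (HasSubtree.append_right (Xs := [Sum.inl A]) ?_ hd'))
        exact ⟨B, hB, x, y, k + 1, u, l, hc.of_rule hr, hu, rfl, by omega⟩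
    · exact Or.inr (Or.inr ((ih.of_rule hr).append_right hd'))

theorem card_heads_le : (heads R).card ≤ R.length :=
  (List.toFinset_card_le _).trans_eq (List.length_map _)

/-- If `K v^ω` is finite, every member of it is given by a parse tree of small height. -/
theorem Derivation.exists_mem_yields {c : GrammarCode α} {v : NonemptyWord α}
    (hfin : (mulOmegaPow (GrammarCode.language c) v).Finite) {w : List α} {n : ℕ}
    (h : Derivation c.2 [Sum.inl c.1] w n) :
    ∃ w', (c.1, w') ∈ yields c.2 c.2.length ∧ w' ++ₛ omegaPow v = w ++ₛ omegaPow v := by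
  induction n using Nat.strong_induction_on generalizing w with
  | _ n ih =>
    rcases h.short_or_pump ∅ c.2.length (by simpa using card_heads_le) with h | h | h
    · exact ⟨w, mem_substitutions_singleton.1 h, rfl⟩
    · obtain ⟨A, hA, -⟩ := h
      simp at hA
    · obtain ⟨A, p, q, k, x, y, l, u, m, hc, hl, hpos, hu, rfl, rfl⟩ := h
      -- Induct on the tree with the loop removed; its size drops because `0 < l`, even if its word
      -- is no shorter.
      obtain ⟨w', hw', he⟩ := ih (k + m) (by omega) (hc hu)
      refine ⟨w', hw', he.trans ?_⟩
      have hreg : ∀ z ∈ mulOmegaPow (GrammarCode.language c) v,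
          ∃ u : List α, z = u ++ₛ omegaPow v := fun z ⟨u, _, hz⟩ => ⟨u, hz⟩
      have hpump := pumped_one_append_stream_eq (finite_suffixes hfin hreg)
        (suffixClosed_suffixes _) (x := x) (w := u) (y := y) (z := q ++ₛ omegaPow v) fun i => by
          obtain ⟨m', hm'⟩ := hl.exists_derivation_pumped hu i
          -- Prepending `p` gives a member of `K v^ω`, which is why the suffix set is the right
          -- place to pump.
          refine ⟨p, p ++ pumped x u y i ++ q, mem_language_iff_derivation.2 ⟨_, hc hm'⟩, ?_⟩
          simp
      rw [Stream'.append_append_stream, Stream'.append_append_stream, ← hpump]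
      simp

theorem finite_iff_forall_yields {c : GrammarCode α} {v : NonemptyWord α} :
    (mulOmegaPow (GrammarCode.language c) v).Finite ↔
      ∀ n w, (c.1, w) ∈ yields c.2 n → ∃ w', (c.1, w') ∈ yields c.2 c.2.length ∧
        w' ++ₛ omegaPow v = w ++ₛ omegaPow v := by
  constructor
  · intro h n w hw
    obtain ⟨m, hm⟩ := mem_language_iff_derivation.1 (mem_language_iff_yields.2 ⟨n, hw⟩)
    exact hm.exists_mem_yields h
  · intro h
    refine ((List.finite_toSet (yields c.2 c.2.length)).image
      fun t => t.2 ++ₛ omegaPow v).subset ?_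
    rintro _ ⟨u, hu, rfl⟩
    obtain ⟨n, hn⟩ := mem_language_iff_yields.1 hu
    obtain ⟨w', hw', he⟩ := h n u hn
    exact ⟨_, hw', he⟩

/-! ### Certificates of finiteness -/

/-- Two words act in the same way on the set `Q` of `ω`-words. -/
def Agree (Q : Set (Stream' α)) (w w' : List α) : Prop :=
  ∀ s ∈ Q, ∀ t ∈ Q, w ++ₛ s = t ↔ w' ++ₛ s = t

/-- The intermediate ω-word is a suffix of an element of `Q`, hence lies in `Q`, where agreement of
the left factors can be used. -/
theorem Agree.append {Q : Set (Stream' α)} (hQ : SuffixClosed Q) {w₁ w₁' w₂ w₂' : List α}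
    (h₁ : Agree Q w₁ w₁') (h₂ : Agree Q w₂ w₂') : Agree Q (w₁ ++ w₂) (w₁' ++ w₂') := by
  intro s hs t ht
  rw [Stream'.append_append_stream, Stream'.append_append_stream]
  constructor
  · intro h
    have hm : w₂ ++ₛ s ∈ Q := hQ w₁ _ (h ▸ ht)
    rw [(h₂ s hs _ hm).1 rfl]
    exact (h₁ _ hm t ht).1 h
  · intro h
    have hm : w₂' ++ₛ s ∈ Q := hQ w₁' _ (h ▸ ht)
    rw [(h₂ s hs _ hm).2 rfl]
    exact (h₁ _ hm t ht).2 h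

theorem exists_agree_of_mem_substitutions {Q : Set (Stream' α)} (hQ : SuffixClosed Q)
    {Y Y' : List (ℕ × List α)} (h : ∀ A w, (A, w) ∈ Y → ∃ w', (A, w') ∈ Y' ∧ Agree Q w w')
    {Xs : List (ℕ ⊕ α)} {w : List α} (hw : w ∈ substitutions Y Xs) :
    ∃ w' ∈ substitutions Y' Xs, Agree Q w w' := by
  induction Xs generalizing w with
  | nil => exact ⟨w, hw, fun _ _ _ _ => Iff.rfl⟩
  | cons X Xs ih =>
    rcases X with A | a
    · obtain ⟨w₁, w₂, h₁, h₂, rfl⟩ := mem_substitutions_nonterminal.1 hw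
      obtain ⟨w₁', h₁', e₁⟩ := h A w₁ h₁
      obtain ⟨w₂', h₂', e₂⟩ := ih h₂
      exact ⟨_, mem_substitutions_nonterminal.2 ⟨_, _, h₁', h₂', rfl⟩, e₁.append hQ e₂⟩
    · obtain ⟨w₂, h₂, rfl⟩ := mem_substitutions_terminal.1 hw
      obtain ⟨w₂', h₂', e₂⟩ := ih h₂
      exact ⟨_, mem_substitutions_terminal.2 ⟨_, h₂', rfl⟩,
        Agree.append (w₁ := [a]) (w₁' := [a]) hQ (fun _ _ _ _ => Iff.rfl) e₂⟩

/-- Saturation: replace the subtrees below the root by agreeing ones of height at most `n`; the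
result has height at most `n + 1`, and the hypothesis brings it back to `n`. -/
theorem exists_agree_of_mem_yields {R : List (ℕ × List (ℕ ⊕ α))} {Q : Set (Stream' α)}
    (hQ : SuffixClosed Q) {n : ℕ}
    (h : ∀ A w, (A, w) ∈ yields R (n + 1) → ∃ w', (A, w') ∈ yields R n ∧ Agree Q w w')
    (m A : ℕ) (w : List α) (hw : (A, w) ∈ yields R m) :
    ∃ w', (A, w') ∈ yields R n ∧ Agree Q w w' := by
  induction m generalizing A w with
  | zero => simp [yields_zero] at hw
  | succ m ih =>
    obtain ⟨rhs, hr, hw⟩ := mem_yields_succ.1 hw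
    obtain ⟨w', hw', e'⟩ := exists_agree_of_mem_substitutions hQ ih hw
    obtain ⟨w'', hw'', e''⟩ := h A w' (mem_yields_succ.2 ⟨rhs, hr, hw'⟩)
    exact ⟨w'', hw'', fun s hs t ht => (e' s hs t ht).trans (e'' s hs t ht)⟩

theorem fst_mem_heads {R : List (ℕ × List (ℕ ⊕ α))} {n A : ℕ} {w : List α}
    (h : (A, w) ∈ yields R n) : A ∈ heads R := by
  cases n with
  | zero => simp [yields_zero] at h
  | succ n =>
    obtain ⟨rhs, hr, -⟩ := mem_yields_succ.1 h
    exact List.mem_toFinset.2 (List.mem_map.2 ⟨_, hr, rfl⟩)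

/-- Up to agreement on a finite set, the yields of all parse trees occur at a bounded height. -/
theorem exists_height_agree (R : List (ℕ × List (ℕ ⊕ α))) {Q : Set (Stream' α)} (hQ : Q.Finite) :
    ∃ n, ∀ m A w, (A, w) ∈ yields R m → ∃ w', (A, w') ∈ yields R n ∧ Agree Q w w' := by
  -- A key is a nonterminal with the graph of the action on `Q`. Only finitely many keys occur;
  -- choose a height realising each and take the maximum.
  let key : ℕ × List α → ℕ × Set (Stream' α × Stream' α) := fun t =>
    (t.1, {p | p ∈ Q ×ˢ Q ∧ t.2 ++ₛ p.1 = p.2})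
  have hfin : (key '' {t | ∃ m, t ∈ yields R m}).Finite := by
    refine (((heads R).finite_toSet).prod (hQ.prod hQ).finite_subsets).subset ?_
    rintro _ ⟨⟨A, w⟩, ⟨m, hm⟩, rfl⟩
    exact ⟨fst_mem_heads hm, fun p hp => hp.1⟩
  have hex : ∀ k ∈ key '' {t | ∃ m, t ∈ yields R m}, ∃ m, ∃ t ∈ yields R m, key t = k := by
    rintro _ ⟨t, ⟨m, hm⟩, rfl⟩
    exact ⟨m, t, hm, rfl⟩
  choose! f hf using hex
  refine ⟨hfin.toFinset.sup f, fun m A w hw => ?_⟩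
  have hmem : key (A, w) ∈ key '' {t | ∃ m, t ∈ yields R m} := ⟨_, ⟨m, hw⟩, rfl⟩
  obtain ⟨⟨B, w'⟩, hw', he⟩ := hf _ hmem
  obtain rfl : B = A := congrArg Prod.fst he
  refine ⟨w', yields_subset (Finset.le_sup (hfin.mem_toFinset.2 hmem)) hw', fun s hs t ht => ?_⟩
  have := Set.ext_iff.1 (congrArg Prod.snd he) (s, t)
  simpa [key, hs, ht] using this.symm

/-- The `ω`-words `q v^ω` for `q` in a list. -/
def tailSet (v : NonemptyWord α) (Q : List (List α)) : Set (Stream' α) :=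
  {s | ∃ q ∈ Q, s = q ++ₛ omegaPow v}

/-- `t v^ω` is one of the `ω`-words given by `Q`. -/
def MemTails (v : NonemptyWord α) (Q : List (List α)) (t : List α) : Prop :=
  ∃ q ∈ Q, SameTail v.1 t q

theorem memTails_iff {v : NonemptyWord α} {Q : List (List α)} {t : List α} :
    MemTails v Q t ↔ t ++ₛ omegaPow v ∈ tailSet v Q := by
  simp [MemTails, tailSet, sameTail_iff]

/-- A checkable form of `Agree (tailSet v Q) w w'`. -/
def AgreeOn (v : NonemptyWord α) (Q : List (List α)) (w w' : List α) : Prop :=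
  ∀ q ∈ Q, ∀ q' ∈ Q, (SameTail v.1 (w ++ q) q' ↔ SameTail v.1 (w' ++ q) q')

theorem agreeOn_iff {v : NonemptyWord α} {Q : List (List α)} {w w' : List α} :
    AgreeOn v Q w w' ↔ Agree (tailSet v Q) w w' := by
  simp only [AgreeOn, Agree, tailSet, sameTail_iff, Stream'.append_append_stream,
    Set.mem_ofPred_eq]
  constructor
  · rintro h _ ⟨q, hq, rfl⟩ _ ⟨q', hq', rfl⟩
    exact h q hq q' hq'
  · intro h q hq q' hq'
    exact h _ ⟨q, hq, rfl⟩ _ ⟨q', hq', rfl⟩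

/-- A finite certificate, consisting of a list of words and a height, that the language of a
grammar gives finitely many `ω`-words with period `v`. -/
def IsCertificate (p : GrammarCode α × NonemptyWord α) (d : List (List α) × ℕ) : Prop :=
  (∀ q ∈ d.1, MemTails p.2 d.1 (q ++ p.2.1).tail) ∧
  (∀ t ∈ yields p.1.2 (d.2 + 1), ∃ t' ∈ yields p.1.2 d.2, t.1 = t'.1 ∧ AgreeOn p.2 d.1 t.2 t'.2) ∧
  (∀ t ∈ yields p.1.2 d.2, t.1 = p.1.1 → MemTails p.2 d.1 t.2) ∧
  [] ∈ d.1

/-- One copy of `v` is unrolled first so that removing a letter also works for empty `q`. -/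
theorem tail_append_stream (q : List α) (v : NonemptyWord α) :
    (q ++ v.1).tail ++ₛ omegaPow v = (q ++ₛ omegaPow v).tail := by
  conv_rhs => rw [omegaPow_eq, ← Stream'.append_append_stream]
  have : q ++ v.1 ≠ [] := by simp [v.2]
  cases h : q ++ v.1 with
  | nil => exact absurd h this
  | cons a l => rfl

theorem suffixClosed_of_tail {Q : Set (Stream' α)} (h : ∀ s ∈ Q, s.tail ∈ Q) : SuffixClosed Q := by
  intro u t
  induction u with
  | nil => exact id
  | cons a u ih => exact fun hu => ih (h _ hu)

theorem tailSet_suffixClosed {v : NonemptyWord α} {Q : List (List α)}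
    (h : ∀ q ∈ Q, MemTails v Q (q ++ v.1).tail) : SuffixClosed (tailSet v Q) := by
  refine suffixClosed_of_tail ?_
  rintro _ ⟨q, hq, rfl⟩
  rw [← tail_append_stream]
  exact memTails_iff.1 (h q hq)

theorem finite_of_isCertificate {p : GrammarCode α × NonemptyWord α} {d : List (List α) × ℕ}
    (h : IsCertificate p d) : (mulOmegaPow (GrammarCode.language p.1) p.2).Finite := by
  obtain ⟨⟨S, R⟩, v⟩ := p
  obtain ⟨Q, n⟩ := d
  obtain ⟨h1, h2, h3, h4⟩ := h
  have hQ := tailSet_suffixClosed h1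
  refine ((List.finite_toSet (yields R n)).image fun t => t.2 ++ₛ omegaPow v).subset ?_
  rintro _ ⟨u, hu, rfl⟩
  obtain ⟨m, hm⟩ := mem_language_iff_yields.1 hu
  obtain ⟨w, hw, e⟩ := exists_agree_of_mem_yields hQ (fun A w hw => by
    obtain ⟨⟨B, w'⟩, hw', rfl, e⟩ := h2 _ hw
    exact ⟨w', hw', agreeOn_iff.1 e⟩) m S u hm
  -- The representative `w` sends `v^ω` into the certified set, so agreement there turns into
  -- equality of the two ω-words.
  exact ⟨_, hw, ((e _ ⟨[], h4, rfl⟩ _ (memTails_iff.1 (h3 _ hw rfl))).2 rfl).symm⟩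

theorem exists_tailSet_eq {v : NonemptyWord α} {F : Set (Stream' α)} (hF : F.Finite)
    (hreg : ∀ z ∈ F, ∃ u : List α, z = u ++ₛ omegaPow v) :
    ∃ Q : List (List α), tailSet v Q = F := by
  choose! f hf using hreg
  refine ⟨hF.toFinset.toList.map f, Set.ext fun s => ?_⟩
  simp only [tailSet, List.mem_map, Finset.mem_toList, Set.Finite.mem_toFinset, Set.mem_ofPred_eq]
  constructor
  · rintro ⟨_, ⟨z, hz, rfl⟩, rfl⟩
    rwa [← hf z hz]
  · exact fun hs => ⟨_, ⟨s, hs, rfl⟩, hf s hs⟩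

theorem exists_isCertificate {p : GrammarCode α × NonemptyWord α}
    (h : (mulOmegaPow (GrammarCode.language p.1) p.2).Finite) : ∃ d, IsCertificate p d := by
  obtain ⟨⟨S, R⟩, v⟩ := p
  -- `v^ω` is inserted because agreement compares actions only at points of the set.
  have hreg : ∀ z ∈ insert (omegaPow v) (mulOmegaPow (GrammarCode.language (S, R)) v),
      ∃ u : List α, z = u ++ₛ omegaPow v := by
    rintro z (rfl | ⟨u, _, hz⟩)
    exacts [⟨[], rfl⟩, ⟨u, hz⟩]
  have hfin := finite_suffixes (h.insert (omegaPow v)) hreg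
  obtain ⟨Q, hQ⟩ := exists_tailSet_eq hfin fun _ => exists_eq_append_of_mem_suffixes hreg
  -- A certificate must contain the empty word literally; it names `v^ω`, so the set is unchanged.
  have hQ' : tailSet v ([] :: Q) = tailSet v Q := by
    refine Set.Subset.antisymm ?_ fun s ⟨q, hq, hs⟩ => ⟨q, List.mem_cons_of_mem _ hq, hs⟩
    rintro s ⟨q, hq, rfl⟩
    rcases List.mem_cons.1 hq with rfl | hq
    · rw [hQ]
      exact subset_suffixes _ (Set.mem_insert _ _)
    · exact ⟨q, hq, rfl⟩
  obtain ⟨n, hn⟩ := exists_height_agree R (Q := tailSet v ([] :: Q)) (by rw [hQ', hQ]; exact hfin)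
  refine ⟨([] :: Q, n), fun q hq => ?_, ?_, ?_, List.mem_cons_self⟩
  · rw [memTails_iff, tail_append_stream, hQ', hQ]
    have hs : q ++ₛ omegaPow v ∈ suffixes (insert (omegaPow v)
        (mulOmegaPow (GrammarCode.language (S, R)) v)) := by
      rw [← hQ, ← hQ']
      exact ⟨q, hq, rfl⟩
    rw [← Stream'.append_stream_head_tail (q ++ₛ omegaPow v)] at hs
    exact suffixClosed_suffixes _ _ _ hs
  · rintro ⟨A, w⟩ hw
    obtain ⟨w', hw', e⟩ := hn _ A w hw
    exact ⟨_, hw', rfl, agreeOn_iff.2 e⟩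
  · rintro ⟨A, w⟩ hw rfl
    rw [memTails_iff, hQ', hQ]
    exact subset_suffixes _ (Or.inr ⟨w, mem_language_iff_yields.2 ⟨n, hw⟩, rfl⟩)

theorem finite_iff_exists_isCertificate {p : GrammarCode α × NonemptyWord α} :
    (mulOmegaPow (GrammarCode.language p.1) p.2).Finite ↔ ∃ d, IsCertificate p d :=
  ⟨exists_isCertificate, fun ⟨_, h⟩ => finite_of_isCertificate h⟩

/-- The words that the grammar derives by parse trees whose height is at most the number of
productions. -/
def shortWords (p : GrammarCode α × NonemptyWord α) : List (List α) :=
  (yields p.1.2 p.1.2.length).flatMap fun t => if t.1 = p.1.1 then [t.2] else []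

theorem mem_shortWords {p : GrammarCode α × NonemptyWord α} {w : List α} :
    w ∈ shortWords p ↔ (p.1.1, w) ∈ yields p.1.2 p.1.2.length := by
  simp only [shortWords, List.mem_flatMap]
  constructor
  · rintro ⟨⟨B, w'⟩, h, hw⟩
    split_ifs at hw with hB
    · obtain rfl : w = w' := by simpa using hw
      exact hB ▸ h
    · simp at hw
  · exact fun h => ⟨_, h, by simp⟩

/-! ### Computability -/

section Primrec

variable {β γ : Type*} [Primcodable β] [Primcodable γ]

theorem primrecPred_forall_mem {f : γ → List β} {P : γ → β → Prop} (hf : Primrec f)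
    (hP : PrimrecRel P) : PrimrecPred fun c => ∀ b ∈ f c, P c b :=
  (PrimrecRel.forall_mem_list (R := fun b c => P c b) (hP.comp Primrec.snd Primrec.fst)).comp
    hf Primrec.id

theorem primrecPred_exists_mem {f : γ → List β} {P : γ → β → Prop} (hf : Primrec f)
    (hP : PrimrecRel P) : PrimrecPred fun c => ∃ b ∈ f c, P c b :=
  (PrimrecRel.exists_mem_list (R := fun b c => P c b) (hP.comp Primrec.snd Primrec.fst)).comp
    hf Primrec.id

theorem primrecPred_imp {p q : γ → Prop} (hp : PrimrecPred p) (hq : PrimrecPred q) :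
    PrimrecPred fun c => p c → q c :=
  (hp.not.or hq).of_eq fun _ => imp_iff_not_or.symm

theorem primrecPred_iff {p q : γ → Prop} (hp : PrimrecPred p) (hq : PrimrecPred q) :
    PrimrecPred fun c => p c ↔ q c :=
  ((primrecPred_imp hp hq).and (primrecPred_imp hq hp)).of_eq fun _ =>
    iff_iff_implies_and_implies.symm

/-- Unbounded search through the codes of candidate witnesses. -/
theorem rePred_exists {P : γ → β → Prop} (hP : PrimrecRel P) : REPred fun c => ∃ b, P c b := by
  classical
  have h : Computable₂ fun (c : γ) (n : ℕ) =>
      (Encodable.decode (α := β) n).bind fun b => if P c b then some () else none := by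
    refine Primrec.to_comp (Primrec.option_bind (Primrec.decode.comp Primrec.snd) ?_)
    exact Primrec.ite (hP.comp (Primrec.fst.comp Primrec.fst) Primrec.snd)
      (Primrec.const _) (Primrec.const _)
  refine (Partrec.rfindOpt h).dom_re.of_eq fun c => ?_
  rw [Nat.rfindOpt_dom]
  constructor
  · rintro ⟨n, u, hu⟩
    obtain ⟨b, -, hb⟩ := Option.bind_eq_some_iff.1 hu
    refine ⟨b, by_contra fun hn => ?_⟩
    simp [hn] at hb
  · rintro ⟨b, hb⟩
    exact ⟨Encodable.encode b, (), by simp [hb]⟩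

variable [Primcodable α]

theorem primrec_letter {f g : γ → List α} {h : γ → ℕ} (hf : Primrec f) (hg : Primrec g)
    (hh : Primrec h) : Primrec fun c => letter (f c) (g c) (h c) :=
  Primrec.ite (Primrec.nat_lt.comp hh (Primrec.list_length.comp hg))
    (Primrec.list_getElem?.comp hg hh)
    (Primrec.list_getElem?.comp hf (Primrec.nat_mod.comp
      (Primrec.nat_sub.comp hh (Primrec.list_length.comp hg)) (Primrec.list_length.comp hf)))

theorem primrecPred_sameTail {f g h : γ → List α} (hf : Primrec f) (hg : Primrec g)
    (hh : Primrec h) : PrimrecPred fun c => SameTail (f c) (g c) (h c) := by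
  refine (primrecPred_forall_mem (f := fun c => List.range
    ((g c).length + (h c).length + (f c).length))
    (P := fun c n => letter (f c) (g c) n = letter (f c) (h c) n) ?_ ?_).of_eq
    fun c => by simp [SameTail]
  · exact Primrec.list_range.comp (Primrec.nat_add.comp (Primrec.nat_add.comp
      (Primrec.list_length.comp hg) (Primrec.list_length.comp hh)) (Primrec.list_length.comp hf))
  · have h1 : ∀ {k : γ → List α}, Primrec k → Primrec fun p : γ × ℕ => k p.1 :=
      fun hk => hk.comp Primrec.fst
    exact Primrec.eq.comp (primrec_letter (h1 hf) (h1 hg) Primrec.snd)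
      (primrec_letter (h1 hf) (h1 hh) Primrec.snd)

theorem primrec_period {f : γ → NonemptyWord α} (hf : Primrec f) : Primrec fun c => (f c).1 :=
  Primrec.subtype_val.comp hf

theorem primrecPred_memTails {f : γ → NonemptyWord α} {g : γ → List (List α)} {h : γ → List α}
    (hf : Primrec f) (hg : Primrec g) (hh : Primrec h) :
    PrimrecPred fun c => MemTails (f c) (g c) (h c) :=
  primrecPred_exists_mem hg (primrecPred_sameTail ((primrec_period hf).comp Primrec.fst)
    (hh.comp Primrec.fst) Primrec.snd)

theorem primrecPred_agreeOn {f : γ → NonemptyWord α} {g : γ → List (List α)} {h k : γ → List α}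
    (hf : Primrec f) (hg : Primrec g) (hh : Primrec h) (hk : Primrec k) :
    PrimrecPred fun c => AgreeOn (f c) (g c) (h c) (k c) := by
  have h2 : ∀ {l : γ → List α}, Primrec l →
      Primrec fun p : (γ × List α) × List α => l p.1.1 ++ p.1.2 := fun hl =>
    Primrec.list_append.comp (hl.comp (Primrec.fst.comp Primrec.fst))
      (Primrec.snd.comp Primrec.fst)
  have h1 : Primrec fun p : (γ × List α) × List α => (f p.1.1).1 :=
    (primrec_period hf).comp (Primrec.fst.comp Primrec.fst)
  refine primrecPred_forall_mem hg (primrecPred_forall_mem (hg.comp Primrec.fst) ?_)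
  exact primrecPred_iff (primrecPred_sameTail h1 (h2 hh) Primrec.snd)
    (primrecPred_sameTail h1 (h2 hk) Primrec.snd)

theorem primrec_prepend {f : γ → List (ℕ × List α)} {g : γ → ℕ ⊕ α} {h : γ → List α}
    (hf : Primrec f) (hg : Primrec g) (hh : Primrec h) :
    Primrec fun c => prepend (f c) (g c) (h c) := by
  unfold prepend
  refine Primrec.sumCasesOn hg ?_ ?_
  · refine Primrec.list_flatMap (hf.comp Primrec.fst) (Primrec.ite ?_ ?_ (Primrec.const _))
    · exact Primrec.eq.comp (Primrec.fst.comp Primrec.snd) (Primrec.snd.comp Primrec.fst)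
    · exact Primrec.list_cons.comp (Primrec.list_append.comp (Primrec.snd.comp Primrec.snd)
        (hh.comp (Primrec.fst.comp Primrec.fst))) (Primrec.const [])
  · exact Primrec.list_cons.comp (Primrec.list_cons.comp Primrec.snd (hh.comp Primrec.fst))
      (Primrec.const [])

theorem primrec_substitutions {f : γ → List (ℕ × List α)} {g : γ → List (ℕ ⊕ α)}
    (hf : Primrec f) (hg : Primrec g) : Primrec fun c => substitutions (f c) (g c) := by
  have h : Primrec₂ fun (c : γ) (p : (ℕ ⊕ α) × List (List α)) =>
      p.2.flatMap (prepend (f c) p.1) := by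
    refine Primrec.list_flatMap (Primrec.snd.comp Primrec.snd) ?_
    exact primrec_prepend (hf.comp (Primrec.fst.comp Primrec.fst))
      (Primrec.fst.comp (Primrec.snd.comp Primrec.fst)) Primrec.snd
  exact Primrec.list_foldr hg (Primrec.const [[]]) h

theorem primrec_yields {f : γ → List (ℕ × List (ℕ ⊕ α))} {g : γ → ℕ} (hf : Primrec f)
    (hg : Primrec g) : Primrec fun c => yields (f c) (g c) := by
  refine Primrec.nat_iterate hg (Primrec.const []) (Primrec.list_flatMap
    (hf.comp Primrec.fst) (Primrec.list_map ?_ ?_))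
  · exact primrec_substitutions (Primrec.snd.comp Primrec.fst) (Primrec.snd.comp Primrec.snd)
  · exact Primrec.pair (Primrec.fst.comp (Primrec.snd.comp Primrec.fst)) Primrec.snd

theorem primrecRel_isCertificate :
    PrimrecRel (IsCertificate : GrammarCode α × NonemptyWord α → List (List α) × ℕ → Prop) := by
  have hv : Primrec fun x : (GrammarCode α × NonemptyWord α) × (List (List α) × ℕ) => x.1.2 :=
    Primrec.snd.comp Primrec.fst
  have hQ : Primrec fun x : (GrammarCode α × NonemptyWord α) × (List (List α) × ℕ) => x.2.1 :=
    Primrec.fst.comp Primrec.snd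
  have hn : Primrec fun x : (GrammarCode α × NonemptyWord α) × (List (List α) × ℕ) => x.2.2 :=
    Primrec.snd.comp Primrec.snd
  have hS : Primrec fun x : (GrammarCode α × NonemptyWord α) × (List (List α) × ℕ) => x.1.1.1 :=
    Primrec.fst.comp (Primrec.fst.comp Primrec.fst)
  have hR : Primrec fun x : (GrammarCode α × NonemptyWord α) × (List (List α) × ℕ) => x.1.1.2 :=
    Primrec.snd.comp (Primrec.fst.comp Primrec.fst)
  refine PrimrecPred.and ?_ (PrimrecPred.and ?_ (PrimrecPred.and ?_ ?_))
  · refine primrecPred_forall_mem hQ (primrecPred_memTails (hv.comp Primrec.fst)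
      (hQ.comp Primrec.fst) (Primrec.list_tail.comp (Primrec.list_append.comp Primrec.snd
        ((primrec_period hv).comp Primrec.fst))))
  · refine primrecPred_forall_mem (primrec_yields hR (Primrec.succ.comp hn))
      (primrecPred_exists_mem ((primrec_yields hR hn).comp Primrec.fst) (PrimrecPred.and ?_ ?_))
    · exact Primrec.eq.comp (Primrec.fst.comp (Primrec.snd.comp Primrec.fst))
        (Primrec.fst.comp Primrec.snd)
    · exact primrecPred_agreeOn (hv.comp (Primrec.fst.comp Primrec.fst))
        (hQ.comp (Primrec.fst.comp Primrec.fst))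
        (Primrec.snd.comp (Primrec.snd.comp Primrec.fst)) (Primrec.snd.comp Primrec.snd)
  · refine primrecPred_forall_mem (primrec_yields hR hn) (primrecPred_imp ?_ ?_)
    · exact Primrec.eq.comp (Primrec.fst.comp Primrec.snd) (hS.comp Primrec.fst)
    · exact primrecPred_memTails (hv.comp Primrec.fst) (hQ.comp Primrec.fst)
        (Primrec.snd.comp Primrec.snd)
  · exact (primrecPred_exists_mem (P := fun _ q => q = []) hQ
      (Primrec.eq.comp Primrec.snd (Primrec.const []))).of_eq fun x => by simp

theorem primrec_shortWords :
    Primrec (shortWords : GrammarCode α × NonemptyWord α → List (List α)) := by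
  have hS : Primrec fun p : GrammarCode α × NonemptyWord α => p.1.1 :=
    Primrec.fst.comp Primrec.fst
  have hR : Primrec fun p : GrammarCode α × NonemptyWord α => p.1.2 :=
    Primrec.snd.comp Primrec.fst
  refine Primrec.list_flatMap (primrec_yields hR (Primrec.list_length.comp hR))
    (Primrec.ite ?_ ?_ (Primrec.const _))
  · exact Primrec.eq.comp (Primrec.fst.comp Primrec.snd) (hS.comp Primrec.fst)
  · exact Primrec.list_cons.comp (Primrec.snd.comp Primrec.snd) (Primrec.const [])

/-- Some parse tree of height at most `n` gives an `ω`-word that the short words do not give. -/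
def HasNewWord (p : GrammarCode α × NonemptyWord α) (n : ℕ) : Prop :=
  ∃ t ∈ yields p.1.2 n, t.1 = p.1.1 ∧ ¬MemTails p.2 (shortWords p) t.2

theorem primrecRel_hasNewWord :
    PrimrecRel (HasNewWord : GrammarCode α × NonemptyWord α → ℕ → Prop) := by
  refine primrecPred_exists_mem (primrec_yields (Primrec.snd.comp (Primrec.fst.comp Primrec.fst))
    Primrec.snd) (PrimrecPred.and ?_ (PrimrecPred.not ?_))
  · exact Primrec.eq.comp (Primrec.fst.comp Primrec.snd)
      (Primrec.fst.comp (Primrec.fst.comp (Primrec.fst.comp Primrec.fst)))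
  · exact primrecPred_memTails (Primrec.snd.comp (Primrec.fst.comp Primrec.fst))
      (primrec_shortWords.comp (Primrec.fst.comp Primrec.fst)) (Primrec.snd.comp Primrec.snd)

end Primrec

/-! ### The decision procedure and the list of members -/

theorem not_finite_iff_exists_hasNewWord {p : GrammarCode α × NonemptyWord α} :
    ¬(mulOmegaPow (GrammarCode.language p.1) p.2).Finite ↔ ∃ n, HasNewWord p n := by
  rw [finite_iff_forall_yields]
  simp only [HasNewWord, MemTails, mem_shortWords, sameTail_iff]
  constructor
  · intro h
    push Not at h
    obtain ⟨n, w, hw, h⟩ := h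
    exact ⟨n, _, hw, rfl, fun ⟨q, hq, he⟩ => h q hq he.symm⟩
  · rintro ⟨n, ⟨A, w⟩, hw, rfl, h⟩ hall
    obtain ⟨w', hw', he⟩ := hall n w hw
    exact h ⟨w', hw', he.symm⟩

/-- Post's theorem: search simultaneously for a certificate and for a new word. -/
theorem computablePred_finite [Primcodable α] :
    ComputablePred fun p : GrammarCode α × NonemptyWord α =>
      (mulOmegaPow (GrammarCode.language p.1) p.2).Finite :=
  ComputablePred.computable_iff_re_compl_re'.2
    ⟨(rePred_exists primrecRel_isCertificate).of_eq fun _ => finite_iff_exists_isCertificate.symm,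
      (rePred_exists primrecRel_hasNewWord).of_eq fun _ => not_finite_iff_exists_hasNewWord.symm⟩

theorem mulOmegaPow_eq_shortWords {c : GrammarCode α} {v : NonemptyWord α}
    (h : (mulOmegaPow (GrammarCode.language c) v).Finite) :
    mulOmegaPow (GrammarCode.language c) v =
      {w | ∃ u ∈ shortWords (c, v), w = u ++ₛ omegaPow v} := by
  refine Set.Subset.antisymm ?_ ?_
  · rintro _ ⟨u, hu, rfl⟩
    obtain ⟨n, hn⟩ := mem_language_iff_yields.1 hu
    obtain ⟨w, hw, he⟩ := finite_iff_forall_yields.1 h n u hn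
    exact ⟨w, mem_shortWords.2 hw, he.symm⟩
  · rintro _ ⟨u, hu, rfl⟩
    exact ⟨u, mem_language_iff_yields.2 ⟨_, mem_shortWords.1 hu⟩, rfl⟩

end OmegaLang

theorem mainTheorem7 {α : Type*} [Primcodable α] :
    ComputablePred (fun p : OmegaLang.GrammarCode α × OmegaLang.NonemptyWord α =>
      (OmegaLang.mulOmegaPow (OmegaLang.GrammarCode.language p.1) p.2).Finite) ∧
    (∀ (K : Language α) (v : OmegaLang.NonemptyWord α),
      ∀ w ∈ OmegaLang.mulOmegaPow K v, OmegaLang.IsRegularWord w) ∧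
    ∃ members : OmegaLang.GrammarCode α × OmegaLang.NonemptyWord α → List (List α),
      Computable members ∧
      ∀ (c : OmegaLang.GrammarCode α) (v : OmegaLang.NonemptyWord α),
        (OmegaLang.mulOmegaPow (OmegaLang.GrammarCode.language c) v).Finite →
        OmegaLang.mulOmegaPow (OmegaLang.GrammarCode.language c) v =
          {w | ∃ u ∈ members (c, v), w = u ++ₛ OmegaLang.omegaPow v} :=
  ⟨OmegaLang.computablePred_finite, fun _ v _ ⟨u, _, h⟩ => ⟨u, v.1, v.2, h⟩,
    OmegaLang.shortWords, OmegaLang.primrec_shortWords.to_comp,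
    fun _ _ => OmegaLang.mulOmegaPow_eq_shortWords⟩
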